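/- All structures are in a countable signature with relation and constant symbols only (no function symbols of positive arity). For a structure $\mathfrak M$ with universe $M$, the endomorphism monoid $\mathrm{End}(\mathfrak M)\subseteq M^M$ carries the topology of pointwise convergence ($M$ discrete); for $\Sigma\subseteq \mathrm{End}(\mathfrak M)$ the orbit of $m\in M$ under $\Sigma$ is $\{\sigma(m)\mid\sigma\in\Sigma\}$. A structure is called $\aleph_0$-categorical if it is finite, or countable with an $\aleph_0$-categorical first-order theory. It is contractible if it has a constant endomorphism. A formula is positive existential if it is built from $\top$, $\bot$ and atomic formulas by $\wedge$, $\vee$ and $\exists$. A structure $\mathfrak B$ is positive existentially interpretable in $\mathfrak A$ if there are $d\in\mathbb N$, a set $U\subseteq A^d$ and a surjection $i\colon U\to B$ such that the inverse images under $i$ of the universe $B$, of the diagonal of $B^2$, and of all interpretations in $\mathfrak B$ of relation symbols and constant symbols are definable in $\mathfrak A$ by positive existential formulas without parameters. **Theorem.** Let $\mathfrak A$ be a non-empty, $\aleph_0$-categorical, non-contractible structure and let $\mathfrak B$ be any structure. Then the following are equivalent: 1. $\mathfrak B$ is positive existentially interpretable in $\mathfrak A$; 2. there is a continuous monoid homomorphism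 $f\colon \mathrm{End}(\mathfrak A)\to\mathrm{End}(\mathfrak B)$ such that $B$ is covered by finitely many orbits under the image of $f$; 3. there is a continuous monoid homomorphism $f\colon \mathrm{End}(\mathfrak A)\to\mathrm{End}(\mathfrak B)$ such that $B$ is covered by finitely many orbits under $f[\mathrm{Aut}(\mathfrak A)]$. Moreover, for every continuous monoid homomorphism $f\colon \mathrm{End}(\mathfrak A)\to\mathrm{End}(\mathfrak B)$, the covering conditions in 2 and 3 are equivalent. -/

import Mathlib

open FirstOrder Cardinal

universe w

namespace PosExInterp

/-- A signature without function symbols of positive arity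
(relation symbols and constant symbols only). -/
def NoFunctionSymbols (L : Language) : Prop :=
  ∀ n : ℕ, IsEmpty (L.Functions (n + 1))

/-- A structure is called `ℵ₀`-categorical if it is finite, or if it is countable and its
first-order theory is `ℵ₀`-categorical. -/
def IsAleph0Categorical (L : Language) (M : Type w) [L.Structure M] : Prop :=
  Finite M ∨ (Countable M ∧ (ℵ₀ : Cardinal.{w}).Categorical (L.completeTheory M))

section Endomorphisms

variable (L : Language) (M : Type*) [L.Structure M]

/-- The monoid `End(M)` of endomorphisms under composition. -/
instance endMonoid : Monoid (M →[L] M) where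
  mul σ τ := σ.comp τ
  one := Language.Hom.id L M
  mul_assoc _ _ _ := rfl
  one_mul _ := rfl
  mul_one _ := rfl

/-- The topology of pointwise convergence on `End(M)`: the subspace topology of the product
`M → M`, where `M` is discrete. -/
instance endTopology : TopologicalSpace (M →[L] M) :=
  TopologicalSpace.induced (fun (σ : M →[L] M) (x : M) => σ x)
    (@Pi.topologicalSpace M (fun _ => M) (fun _ => ⊥))

/-- A structure is contractible if it has a constant endomorphism. -/
def Contractible : Prop :=
  ∃ (σ : M →[L] M) (c : M), ∀ x : M, σ x = c

/-- `Aut(M)`, as a set of endomorphisms. -/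
def autSet : Set (M →[L] M) :=
  Set.range fun α : M ≃[L] M => α.toHom

variable {L M}

/-- The orbit of `m` under a set of endomorphisms. -/
def orbit (S : Set (M →[L] M)) (m : M) : Set M :=
  {x | ∃ σ ∈ S, σ m = x}

/-- `M` is the union of finitely many orbits under `S`. -/
def CoveredByFinitelyManyOrbits (S : Set (M →[L] M)) : Prop :=
  ∃ F : Set M, F.Finite ∧ (⋃ m ∈ F, orbit S m) = Set.univ

end Endomorphisms

section Definability

/-- Positive existential formulas: built from `⊥`, `⊤` and atomic formulas by `∧`, `∨`, `∃`. -/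
inductive IsPosEx {L : Language} {α : Type*} : ∀ {n : ℕ}, L.BoundedFormula α n → Prop
  | bot {n : ℕ} : IsPosEx (⊥ : L.BoundedFormula α n)
  | top {n : ℕ} : IsPosEx (⊤ : L.BoundedFormula α n)
  | atomic {n : ℕ} {φ : L.BoundedFormula α n} (h : φ.IsAtomic) : IsPosEx φ
  | inf {n : ℕ} {φ ψ : L.BoundedFormula α n} (hφ : IsPosEx φ) (hψ : IsPosEx ψ) : IsPosEx (φ ⊓ ψ)
  | sup {n : ℕ} {φ ψ : L.BoundedFormula α n} (hφ : IsPosEx φ) (hψ : IsPosEx ψ) : IsPosEx (φ ⊔ ψ)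
  | ex {n : ℕ} {φ : L.BoundedFormula α (n + 1)} (hφ : IsPosEx φ) : IsPosEx φ.ex

/-- A set of `α`-tuples that is defined, without parameters, by a positive existential formula. -/
def PosExDefinable (L : Language) {M : Type*} [L.Structure M] {α : Type*}
    (X : Set (α → M)) : Prop :=
  ∃ φ : L.Formula α, IsPosEx φ ∧ X = {v | φ.Realize v}

/-- The basic sets of a structure: the universe, the diagonal, the interpretations of the relation
symbols, and the graphs of the interpretations of the function symbols (constants included). -/
inductive IsBasicSet (L : Language) (M : Type*) [L.Structure M] :
    ∀ k : ℕ, Set (Fin k → M) → Prop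
  | universe : IsBasicSet L M 1 Set.univ
  | diagonal : IsBasicSet L M 2 {v | v 0 = v 1}
  | relation {k : ℕ} (R : L.Relations k) : IsBasicSet L M k {v | Language.Structure.RelMap R v}
  | graph {k : ℕ} (f : L.Functions k) :
      IsBasicSet L M (k + 1)
        {v | Language.Structure.funMap f (fun j => v j.castSucc) = v (Fin.last k)}

end Definability

/-- The inverse image of `X ⊆ B ^ k` under a partial map `i : A ^ d ⊇ U → B`, as a set of
`k`-tuples of `d`-tuples of elements of `A`. -/
def tuplePreimage {A B : Type*} {d : ℕ} {U : Set (Fin d → A)} (i : U → B) {k : ℕ}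
    (X : Set (Fin k → B)) : Set (Fin k × Fin d → A) :=
  {y | ∃ h : ∀ j : Fin k, (fun t => y (j, t)) ∈ U, (fun j => i ⟨fun t => y (j, t), h j⟩) ∈ X}

/-- `B` is positive existentially interpretable in `A`: there are a finite power `A ^ d` and a
surjection from some `U ⊆ A ^ d` onto `B` under which the inverse images of all basic sets of `B`
are positive existentially definable in `A`. -/
def PosExInterpretable (L : Language) (A : Type*) [L.Structure A]
    (L' : Language) (B : Type*) [L'.Structure B] : Prop :=
  ∃ (d : ℕ) (U : Set (Fin d → A)) (i : U → B), Function.Surjective i ∧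
    ∀ (k : ℕ) (X : Set (Fin k → B)), IsBasicSet L' B k X →
      PosExDefinable L (tuplePreimage i X)

end PosExInterp

/-!
The implications rest on one finiteness property. By the Ryll-Nardzewski theorem
(`IsAleph0Categorical.oligomorphic`), the automorphism group of `A` has finitely many orbits of
`k`-tuples for every `k`. From it two facts about `End(A)` follow. Sets of tuples closed under
endomorphisms are positive existentially definable (`Oligomorphic.posExDefinable`): if a tuple
shares all positive existential properties of another, a forth construction yields an endomorphism
moving the latter to the former, and only finitely many orbits have to be separated. Moreover,
`End(A)` is compact up to composition with automorphisms on the left (`Oligomorphic.exists_limit`).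

An interpretation `i : U → B` induces the homomorphism given by `f σ (i u) = i (σ u)`
(`PosExInterpretable.exists_continuous_hom`); the finitely many orbits on `A ^ d` give finitely many
orbits on `B`.

Conversely, let `f` be continuous. Compactness makes it uniformly continuous
(`Oligomorphic.exists_finset_determining`): for every `b`, the value `f σ b` depends only on the
restriction of `σ` to some finite set. Hence an orbit of the image of `f` splits into finitely many
orbits of the image of `Aut(A)`, and the two covering conditions agree
(`Oligomorphic.coveredByFinitelyManyOrbits_iff`). If the orbits of `b₁, …, bᵣ` cover `B`, choose
tuples `eⱼ` on which the values `f σ bⱼ` depend; then `σ eⱼ ↦ f σ bⱼ` is the required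
interpretation, all preimages being closed under endomorphisms, provided that
`σ eⱼ = τ eₖ` forces `j = k`. This is where non-contractibility enters: again by compactness, there
is a finite set on which no endomorphism is constant, and placing an enumeration of it in the `j`-th
block of `eⱼ`, with all other blocks constant, marks the index `j`
(`Oligomorphic.posExInterpretable`).

For the Ryll-Nardzewski theorem, every decreasing sequence of nonempty definable sets of tuples has
a common point, by passing to an ultrapower and back to `A` by categoricity. Therefore the isolated
types are dense, and `A` has an atomic elementary substructure, which is isomorphic to `A`. So all
types are isolated, there are finitely many of them, and back and forth turns equality of types into
conjugacy.
-/

namespace PosExInterp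

/-! ### Generic filtrations of finite sets -/

/-- **Rasiowa–Sikorski for finite approximations.** If every finite set satisfying `P` can be
enlarged so as to meet each of countably many requirements `D i`, then some set `G` is exhausted by
finite sets satisfying `P`, among which all requirements are met. -/
theorem exists_generic {X ι : Type*} [Countable ι] (P : Finset X → Prop) (s₀ : Finset X)
    (h₀ : P s₀) (D : ι → Finset X → Prop)
    (hD : ∀ i s, P s → ∃ t, s ⊆ t ∧ P t ∧ D i t) :
    ∃ G : Set X, (∃ t, s₀ ⊆ t ∧ P t ∧ (t : Set X) ⊆ G) ∧
      (∀ s : Finset X, (s : Set X) ⊆ G → ∃ t, s ⊆ t ∧ P t ∧ (t : Set X) ⊆ G) ∧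
      ∀ i, ∃ t, P t ∧ D i t ∧ (t : Set X) ⊆ G := by
  classical
  have : Encodable ι := Encodable.ofCountable ι
  let 𝒟 : ι → Order.Cofinal {s : Finset X // P s} := fun i =>
    ⟨{s | D i s.1}, fun s => by
      obtain ⟨t, hst, ht, hDt⟩ := hD i s.1 s.2
      exact ⟨⟨t, ht⟩, hDt, hst⟩⟩
  let I := Order.idealOfCofinals (⟨s₀, h₀⟩ : {s : Finset X // P s}) 𝒟
  have h₀I : (⟨s₀, h₀⟩ : {s : Finset X // P s}) ∈ I := Order.mem_idealOfCofinals _ _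
  have hsub : ∀ t : {s : Finset X // P s}, t ∈ I →
      (t.1 : Set X) ⊆ {x | ∃ t ∈ I, x ∈ t.1} := fun t ht x hx => ⟨t, ht, hx⟩
  refine ⟨{x | ∃ t ∈ I, x ∈ t.1}, ⟨s₀, subset_rfl, h₀, hsub _ h₀I⟩, fun s hs => ?_, fun i => ?_⟩
  · have : ∃ t ∈ I, s ⊆ t.1 := by
      induction s using Finset.induction_on with
      | empty => exact ⟨_, h₀I, by simp⟩
      | insert a s _ ih =>
        rw [Finset.coe_insert, Set.insert_subset_iff] at hs
        obtain ⟨t, ht, hst⟩ := ih hs.2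
        obtain ⟨t', ht', hat'⟩ := hs.1
        obtain ⟨r, hr, htr, htr'⟩ := I.directed t ht t' ht'
        exact ⟨r, hr, Finset.insert_subset (htr' hat') (hst.trans htr)⟩
    obtain ⟨t, ht, hst⟩ := this
    exact ⟨t.1, hst, t.2, hsub t ht⟩
  · obtain ⟨t, htD, htI⟩ := Order.cofinal_meets_idealOfCofinals
      (⟨s₀, h₀⟩ : {s : Finset X // P s}) 𝒟 i
    exact ⟨t.1, t.2, htD, hsub t htI⟩

/-! ### Positive existential formulas -/

section PosEx

variable {L : Language} {A : Type*} [L.Structure A] {α β : Type*}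

theorem IsPosEx.relabel {n m : ℕ} {φ : L.BoundedFormula α m} (h : IsPosEx φ)
    (g : α → β ⊕ Fin n) : IsPosEx (φ.relabel g) := by
  induction h with
  | bot => exact .bot
  | top => exact .top
  | atomic h => exact .atomic (h.relabel g)
  | inf _ _ h₁ h₂ => exact .inf h₁ h₂
  | sup _ _ h₁ h₂ => exact .sup h₁ h₂
  | ex _ h => rw [Language.BoundedFormula.relabel_ex]; exact .ex h

/-- Homomorphisms preserve positive existential formulas. -/
theorem IsPosEx.realize_hom {B : Type*} [L.Structure B] (σ : A →[L] B) {n : ℕ}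
    {φ : L.BoundedFormula α n} (h : IsPosEx φ) {v : α → A} {x : Fin n → A}
    (hφ : φ.Realize v x) : φ.Realize (σ ∘ v) (σ ∘ x) := by
  induction h with
  | bot => exact hφ
  | top => simp
  | atomic h =>
    cases h with
    | equal t₁ t₂ =>
      simp only [Language.BoundedFormula.realize_bdEqual, ← Sum.comp_elim,
        Language.HomClass.realize_term] at hφ ⊢
      rw [hφ]
    | rel R ts =>
      simp only [Language.BoundedFormula.realize_rel, ← Sum.comp_elim,
        Language.HomClass.realize_term] at hφ ⊢
      exact σ.map_rel R _ hφ
  | inf _ _ h₁ h₂ =>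
    rw [Language.BoundedFormula.realize_inf] at hφ ⊢
    exact ⟨h₁ hφ.1, h₂ hφ.2⟩
  | sup _ _ h₁ h₂ =>
    rw [Language.BoundedFormula.realize_sup] at hφ ⊢
    exact hφ.imp h₁ h₂
  | ex _ h =>
    rw [Language.BoundedFormula.realize_ex] at hφ ⊢
    obtain ⟨a, ha⟩ := hφ
    refine ⟨σ a, ?_⟩
    rw [← Fin.comp_snoc]
    exact h ha

variable {X Y : Set (α → A)}

theorem PosExDefinable.comp_mem (hX : PosExDefinable L X) (σ : A →[L] A) {v : α → A}
    (hv : v ∈ X) : σ ∘ v ∈ X := by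
  obtain ⟨φ, hφ, rfl⟩ := hX
  have := hφ.realize_hom σ hv
  rwa [Subsingleton.elim (σ ∘ default : Fin 0 → A) default] at this

theorem posExDefinable_univ : PosExDefinable L (Set.univ : Set (α → A)) :=
  ⟨⊤, .top, by ext; simp⟩

theorem posExDefinable_empty : PosExDefinable L (∅ : Set (α → A)) :=
  ⟨⊥, .bot, by ext; simp⟩

theorem PosExDefinable.inter (hX : PosExDefinable L X) (hY : PosExDefinable L Y) :
    PosExDefinable L (X ∩ Y) := by
  obtain ⟨φ, hφ, rfl⟩ := hX
  obtain ⟨ψ, hψ, rfl⟩ := hY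
  exact ⟨φ ⊓ ψ, .inf hφ hψ, by ext; simp⟩

theorem PosExDefinable.union (hX : PosExDefinable L X) (hY : PosExDefinable L Y) :
    PosExDefinable L (X ∪ Y) := by
  obtain ⟨φ, hφ, rfl⟩ := hX
  obtain ⟨ψ, hψ, rfl⟩ := hY
  exact ⟨φ ⊔ ψ, .sup hφ hψ, by ext; simp⟩

theorem PosExDefinable.biInter {ι : Type*} {F : Set ι} (hF : F.Finite) {Z : ι → Set (α → A)}
    (hZ : ∀ i, PosExDefinable L (Z i)) : PosExDefinable L (⋂ i ∈ F, Z i) := by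
  induction F, hF using Set.Finite.induction_on with
  | empty => simpa using posExDefinable_univ
  | insert _ _ ih => rw [Set.biInter_insert]; exact (hZ _).inter ih

theorem PosExDefinable.biUnion {ι : Type*} {F : Set ι} (hF : F.Finite) {Z : ι → Set (α → A)}
    (hZ : ∀ i, PosExDefinable L (Z i)) : PosExDefinable L (⋃ i ∈ F, Z i) := by
  induction F, hF using Set.Finite.induction_on with
  | empty => simpa using posExDefinable_empty
  | insert _ _ ih => rw [Set.biUnion_insert]; exact (hZ _).union ih

theorem PosExDefinable.preimage_comp (hX : PosExDefinable L X) (g : α → β) :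
    PosExDefinable L {v : β → A | v ∘ g ∈ X} := by
  obtain ⟨φ, hφ, rfl⟩ := hX
  exact ⟨φ.relabel g, hφ.relabel _, by ext; simp [Language.Formula.realize_relabel]⟩

/-- Projecting away one coordinate, named `none`, preserves positive existential definability. -/
theorem PosExDefinable.exists_option {X : Set (Option α → A)} (hX : PosExDefinable L X) :
    PosExDefinable L {v : α → A | ∃ a, (fun o => o.elim a v : Option α → A) ∈ X} := by
  obtain ⟨φ, hφ, rfl⟩ := hX
  let g : Option α → α ⊕ Fin 1 := fun o => o.elim (Sum.inr 0) Sum.inl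
  let ψ : L.BoundedFormula α (0 + 1) := Language.BoundedFormula.relabel (k := 0) g φ
  refine ⟨ψ.ex, .ex (hφ.relabel g), ?_⟩
  ext v
  change _ ↔ Language.BoundedFormula.Realize ψ.ex v default
  rw [Language.BoundedFormula.realize_ex]
  refine exists_congr fun a => ?_
  change _ ↔ Language.BoundedFormula.Realize (Language.BoundedFormula.relabel (k := 0) g φ) _ _
  rw [Language.BoundedFormula.realize_relabel]
  change Language.BoundedFormula.Realize _ _ _ ↔ _
  rw [iff_iff_eq]
  congr 1
  · funext o
    cases o with
    | none => simp [g, Fin.snoc]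
    | some o => simp [g]
  · exact Subsingleton.elim _ _

theorem posExDefinable_eq (i j : α) : PosExDefinable L {v : α → A | v i = v j} :=
  ⟨Language.Term.equal (.var i) (.var j), .atomic (.equal _ _),
    by ext; simp [Language.Formula.realize_equal]⟩

theorem posExDefinable_relMap {n : ℕ} (R : L.Relations n) (g : Fin n → α) :
    PosExDefinable L {v : α → A | Language.Structure.RelMap R (v ∘ g)} :=
  ⟨R.formula fun i => .var (g i), .atomic (.rel _ _),
    by ext; simp [Language.Formula.realize_rel, Function.comp_def]⟩

theorem posExDefinable_funMap {n : ℕ} (f : L.Functions n) (g : Fin n → α) (j : α) :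
    PosExDefinable L {v : α → A | Language.Structure.funMap f (v ∘ g) = v j} :=
  ⟨Language.Term.equal (.func f fun i => .var (g i)) (.var j), .atomic (.equal _ _),
    by ext; simp [Language.Formula.realize_equal, Function.comp_def]⟩

theorem PosExDefinable.definable (hX : PosExDefinable L X) : (∅ : Set A).Definable L X := by
  obtain ⟨φ, -, rfl⟩ := hX
  exact Set.empty_definable_iff.2 ⟨φ, rfl⟩

end PosEx

/-! ### Endomorphisms with prescribed finite parts -/

section Forth

variable {L : Language} {A : Type*} [L.Structure A] {α β : Type*}

variable (L) in
/-- Every positive existential property of the tuple `v` is shared by the tuple `u`. -/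
def PosExLE (v u : α → A) : Prop :=
  ∀ Z : Set (α → A), PosExDefinable L Z → v ∈ Z → u ∈ Z

theorem PosExLE.comp {v u : α → A} (h : PosExLE L v u) (g : β → α) :
    PosExLE L (v ∘ g) (u ∘ g) :=
  fun _ hZ hv => h _ (hZ.preimage_comp g) hv

theorem posExLE_comp_hom (σ : A →[L] A) (v : α → A) : PosExLE L v (σ ∘ v) :=
  fun _ hZ hv => hZ.comp_mem σ hv

variable (L) in
/-- A finite set of pairs, seen as a partial map, preserves positive existential properties. -/
def IsPartialHom (s : Finset (A × A)) : Prop :=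
  PosExLE L (fun p : s => p.1.1) (fun p : s => p.1.2)

theorem IsPartialHom.posExLE {s : Finset (A × A)} (h : IsPartialHom L s) {v u : α → A}
    (hs : ∀ i, (v i, u i) ∈ s) : PosExLE L v u :=
  PosExLE.comp h fun i => (⟨(v i, u i), hs i⟩ : s)

theorem isPartialHom_of_posExLE {s : Finset (A × A)} {v u : α → A} (h : PosExLE L v u)
    (hs : ∀ p ∈ s, ∃ i, (v i, u i) = p) : IsPartialHom L s := by
  choose g hg using fun p : s => hs p.1 p.2
  have h' := h.comp g
  rwa [show v ∘ g = fun p : s => p.1.1 from funext fun p => congrArg Prod.fst (hg p),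
    show u ∘ g = fun p : s => p.1.2 from funext fun p => congrArg Prod.snd (hg p)] at h'

/-- A total relation whose finite parts preserve positive existential properties is the graph of
an endomorphism. -/
theorem exists_hom_of_graph {G : Set (A × A)} (htot : ∀ x, ∃ y, (x, y) ∈ G)
    (hG : ∀ s : Finset (A × A), (s : Set (A × A)) ⊆ G → ∃ t, s ⊆ t ∧ IsPartialHom L t) :
    ∃ ρ : A →[L] A, ∀ p, p ∈ G ↔ ρ p.1 = p.2 := by
  classical
  have hle : ∀ {n : ℕ} {v u : Fin n → A}, (∀ i, (v i, u i) ∈ G) → PosExLE L v u := by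
    intro n v u hvu
    obtain ⟨t, hst, ht⟩ := hG (Finset.univ.image fun i => (v i, u i)) (by
      intro p hp
      obtain ⟨i, -, rfl⟩ := Finset.mem_image.1 hp
      exact hvu i)
    exact ht.posExLE fun i => hst (Finset.mem_image_of_mem _ (Finset.mem_univ i))
  have huniq : ∀ {x y z}, (x, y) ∈ G → (x, z) ∈ G → y = z := by
    intro x y z hy hz
    have := hle (v := ![x, x]) (u := ![y, z]) (by
      intro i; fin_cases i
      exacts [hy, hz]) _ (posExDefinable_eq 0 1) rfl
    simpa using this
  choose ρ hρ using htot
  refine ⟨⟨ρ, fun {n} f x => ?_, fun {n} R x hx => ?_⟩, fun p => ⟨fun hp => huniq (hρ _) hp, ?_⟩⟩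
  · have := hle (v := Fin.snoc (α := fun _ => A) x (Language.Structure.funMap f x))
      (u := ρ ∘ Fin.snoc (α := fun _ => A) x (Language.Structure.funMap f x)) (fun _ => hρ _) _
      (posExDefinable_funMap f Fin.castSucc (Fin.last n)) (by
        simp [Function.comp_def])
    simpa [Function.comp_def] using this.symm
  · exact hle (fun i => hρ (x i)) _ (posExDefinable_relMap R id) hx
  · rintro h
    have := hρ p.1
    change ρ p.1 = p.2 at h
    rwa [h] at this

/-- The forth construction: partial maps with property `P`, extendable to any further argument,
have an endomorphism as a limit. -/
theorem exists_hom_of_forth [Countable A] (P : Finset (A × A) → Prop) (s₀ : Finset (A × A))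
    (h₀ : P s₀) (hP : ∀ s, P s → IsPartialHom L s)
    (hext : ∀ s, P s → ∀ x, ∃ y t, s ⊆ t ∧ (x, y) ∈ t ∧ P t) :
    ∃ ρ : A →[L] A, (∀ p ∈ s₀, ρ p.1 = p.2) ∧
      ∀ S : Finset A, ∃ t, P t ∧ ∀ x ∈ S, (x, ρ x) ∈ t := by
  classical
  obtain ⟨G, ⟨t₀, hst₀, -, ht₀⟩, hfin, htot⟩ :=
    exists_generic P s₀ h₀ (fun (x : A) t => ∃ y, (x, y) ∈ t) fun x s hs => by
      obtain ⟨y, t, hst, hy, ht⟩ := hext s hs x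
      exact ⟨t, hst, ht, y, hy⟩
  obtain ⟨ρ, hρ⟩ := exists_hom_of_graph (L := L) (G := G)
    (fun x => by
      obtain ⟨t, -, ⟨y, hy⟩, htG⟩ := htot x
      exact ⟨y, htG hy⟩)
    (fun s hs => by
      obtain ⟨t, hst, ht, -⟩ := hfin s hs
      exact ⟨t, hst, hP t ht⟩)
  refine ⟨ρ, fun p hp => (hρ p).1 (ht₀ (hst₀ hp)), fun S => ?_⟩
  obtain ⟨t, hst, ht, -⟩ := hfin (S.image fun x => (x, ρ x)) (by
    intro p hp
    obtain ⟨x, -, rfl⟩ := Finset.mem_image.1 hp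
    exact (hρ _).2 rfl)
  exact ⟨t, ht, fun x hx => hst (Finset.mem_image_of_mem _ hx)⟩

end Forth

/-! ### Oligomorphic automorphism groups -/

section Oligomorphic

variable {L : Language} {A : Type*} [L.Structure A] {α : Type*}

variable (L A) in
/-- The automorphism group has only finitely many orbits of `k`-tuples, for every `k`. -/
def Oligomorphic : Prop :=
  ∀ k : ℕ, ∃ F : Set (Fin k → A), F.Finite ∧ ∀ v, ∃ u ∈ F, ∃ g : A ≃[L] A, g ∘ u = v

theorem Oligomorphic.exists_finite (h : Oligomorphic L A) (α : Type*) [Finite α] :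
    ∃ F : Set (α → A), F.Finite ∧ ∀ v, ∃ u ∈ F, ∃ g : A ≃[L] A, g ∘ u = v := by
  obtain ⟨k, ⟨e⟩⟩ := Finite.exists_equiv_fin α
  obtain ⟨F, hF, hcov⟩ := h k
  refine ⟨(· ∘ e) '' F, hF.image _, fun v => ?_⟩
  obtain ⟨u, hu, g, hg⟩ := hcov (v ∘ e.symm)
  refine ⟨_, ⟨u, hu, rfl⟩, g, ?_⟩
  rw [← Function.comp_assoc, hg, Function.comp_assoc]
  simp

theorem PosExDefinable.comp_equiv_mem_iff {X : Set (α → A)} (hX : PosExDefinable L X)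
    (g : A ≃[L] A) {v : α → A} : g ∘ v ∈ X ↔ v ∈ X := by
  refine ⟨fun h => ?_, fun h => hX.comp_mem g.toHom h⟩
  have := hX.comp_mem g.symm.toHom h
  convert this using 1
  funext i
  simp

variable [Finite α]

/-- If each member of `V` is separated from `e` by a positive existential set, then one positive
existential set separates `e` from all of `V`: finitely many orbits have to be avoided. -/
theorem Oligomorphic.exists_separating (h : Oligomorphic L A) (V : Set (α → A)) (e : α → A)
    (hV : ∀ v ∈ V, ∃ Z, PosExDefinable L Z ∧ e ∈ Z ∧ v ∉ Z) :
    ∃ Z, PosExDefinable L Z ∧ e ∈ Z ∧ ∀ v ∈ V, v ∉ Z := by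
  obtain ⟨F, hF, hcov⟩ := h.exists_finite α
  have key : ∀ u : α → A, ∃ Z, PosExDefinable L Z ∧ e ∈ Z ∧
      ∀ g : A ≃[L] A, g ∘ u ∈ V → g ∘ u ∉ Z := by
    intro u
    by_cases hu : ∃ g : A ≃[L] A, g ∘ u ∈ V
    · obtain ⟨g, hg⟩ := hu
      obtain ⟨Z, hZ, heZ, hgZ⟩ := hV _ hg
      exact ⟨Z, hZ, heZ, fun g' _ => by
        rwa [hZ.comp_equiv_mem_iff, ← hZ.comp_equiv_mem_iff g]⟩
    · exact ⟨Set.univ, posExDefinable_univ, trivial, fun g hg => (hu ⟨g, hg⟩).elim⟩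
  choose Z hZ heZ hsep using key
  refine ⟨⋂ u ∈ F, Z u, .biInter hF hZ, Set.mem_iInter₂.2 fun u _ => heZ u, fun v hv hvZ => ?_⟩
  obtain ⟨u, hu, g, rfl⟩ := hcov v
  exact hsep u g hv (Set.mem_iInter₂.1 hvZ u hu)

/-- In a countable oligomorphic structure, a tuple with all positive existential properties of
`v` is the image of `v` under an endomorphism. -/
theorem Oligomorphic.exists_hom_of_posExLE [Countable A] (h : Oligomorphic L A) {v u : α → A}
    (hvu : PosExLE L v u) : ∃ ρ : A →[L] A, ρ ∘ v = u := by
  classical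
  have := Fintype.ofFinite α
  have hext : ∀ s : Finset (A × A), IsPartialHom L s → ∀ x, ∃ y t, s ⊆ t ∧ (x, y) ∈ t ∧
      IsPartialHom L t := by
    intro s hs x
    have key : ∃ y, PosExLE L (fun o : Option s => o.elim x fun p => p.1.1)
        (fun o : Option s => o.elim y fun p => p.1.2) := by
      by_contra! hno
      obtain ⟨Z, hZ, hxZ, hyZ⟩ := h.exists_separating
        {w | ∃ y, w = fun o : Option s => o.elim y fun p => p.1.2}
        (fun o : Option s => o.elim x fun p => p.1.1) (by
          rintro _ ⟨y, rfl⟩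
          have := hno y
          unfold PosExLE at this
          push Not at this
          exact this)
      obtain ⟨y, hy⟩ := hs _ hZ.exists_option ⟨x, hxZ⟩
      exact hyZ _ ⟨y, rfl⟩ hy
    obtain ⟨y, hy⟩ := key
    refine ⟨y, insert (x, y) s, Finset.subset_insert _ _, Finset.mem_insert_self _ _,
      isPartialHom_of_posExLE hy fun p hp => ?_⟩
    obtain rfl | hp := Finset.mem_insert.1 hp
    · exact ⟨none, rfl⟩
    · exact ⟨some ⟨p, hp⟩, rfl⟩
  obtain ⟨ρ, hρ, -⟩ := exists_hom_of_forth (L := L) (IsPartialHom L)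
    (Finset.univ.image fun i => (v i, u i))
    (isPartialHom_of_posExLE hvu (by simp)) (fun _ => id) hext
  exact ⟨ρ, funext fun i => hρ (v i, u i) (Finset.mem_image_of_mem _ (Finset.mem_univ i))⟩

/-- In a countable oligomorphic structure, sets of tuples closed under endomorphisms are positive
existentially definable. -/
theorem Oligomorphic.posExDefinable [Countable A] (h : Oligomorphic L A) {X : Set (α → A)}
    (hX : ∀ (σ : A →[L] A), ∀ v ∈ X, σ ∘ v ∈ X) : PosExDefinable L X := by
  obtain ⟨F, hF, hcov⟩ := h.exists_finite α
  have hsep : ∀ e ∈ X, ∃ Z, PosExDefinable L Z ∧ e ∈ Z ∧ ∀ v ∈ Xᶜ, v ∉ Z := fun e he => by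
    refine h.exists_separating Xᶜ e fun v hv => ?_
    by_contra! hno
    obtain ⟨ρ, rfl⟩ := h.exists_hom_of_posExLE (v := e) (u := v) hno
    exact hv (hX ρ e he)
  have key : ∀ u : α → A, ∃ Z, PosExDefinable L Z ∧ Z ⊆ X ∧
      ∀ g : A ≃[L] A, g ∘ u ∈ X → g ∘ u ∈ Z := by
    intro u
    by_cases hu : ∃ g : A ≃[L] A, g ∘ u ∈ X
    · obtain ⟨g, hg⟩ := hu
      obtain ⟨Z, hZ, hgZ, hXZ⟩ := hsep _ hg
      refine ⟨Z, hZ, fun v hv => by_contra fun hvX => hXZ v hvX hv, fun g' _ => ?_⟩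
      rwa [hZ.comp_equiv_mem_iff, ← hZ.comp_equiv_mem_iff g]
    · exact ⟨∅, posExDefinable_empty, Set.empty_subset _, fun g hg => (hu ⟨g, hg⟩).elim⟩
  choose Z hZ hZX hcovZ using key
  convert PosExDefinable.biUnion hF hZ using 1
  refine subset_antisymm (fun v hv => ?_) (Set.iUnion₂_subset fun u _ => hZX u)
  obtain ⟨u, hu, g, rfl⟩ := hcov v
  exact Set.mem_iUnion₂.2 ⟨u, hu, hcovZ u g hv⟩

open Filter in
/-- **Compactness of the endomorphism monoid modulo automorphisms.** Along an ultrafilter, every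
family of endomorphisms of a countable oligomorphic structure converges, up to composition with
automorphisms on the left. The automorphism may depend on the finite set considered. -/
theorem Oligomorphic.exists_limit [Countable A] (h : Oligomorphic L A) {ι : Type*}
    (u : Ultrafilter ι) (σ : ι → A →[L] A) :
    ∃ ρ : A →[L] A, ∀ S : Finset A, ∀ᶠ n in u, ∃ g : A ≃[L] A, ∀ x ∈ S, g (σ n x) = ρ x := by
  classical
  let P : Finset (A × A) → Prop := fun s => ∀ᶠ n in u, ∃ g : A ≃[L] A, ∀ p ∈ s, g (σ n p.1) = p.2
  have hP : ∀ s, P s → IsPartialHom L s := by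
    intro s hs
    obtain ⟨n, g, hg⟩ := hs.exists
    have himg : (fun p : s => p.1.2) = g.toHom.comp (σ n) ∘ fun p : s => p.1.1 :=
      funext fun p => (hg p.1 p.2).symm
    rw [IsPartialHom, himg]
    exact posExLE_comp_hom _ _
  have hext : ∀ s, P s → ∀ x, ∃ y t, s ⊆ t ∧ (x, y) ∈ t ∧ P t := by
    intro s hs x
    obtain ⟨F, hF, hcov⟩ := h.exists_finite (Option s)
    have h₁ : ∀ᶠ n in u, ∃ w ∈ F, ∃ g g' : A ≃[L] A, (∀ p ∈ s, g (σ n p.1) = p.2) ∧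
        g' ∘ w = fun o : Option s => o.elim (g (σ n x)) fun p => p.1.2 := by
      filter_upwards [hs]
      rintro n ⟨g, hg⟩
      obtain ⟨w, hw, g', hg'⟩ := hcov fun o : Option s => o.elim (g (σ n x)) fun p => p.1.2
      exact ⟨w, hw, g, g', hg, hg'⟩
    -- A finite union is large only if one of its members is: a single orbit is met.
    have h₂ : ∃ w ∈ F, ∀ᶠ n in u, ∃ g g' : A ≃[L] A, (∀ p ∈ s, g (σ n p.1) = p.2) ∧
        g' ∘ w = fun o : Option s => o.elim (g (σ n x)) fun p => p.1.2 := by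
      by_contra hno
      have : ∀ᶠ n in u, ∀ w ∈ F, ¬ ∃ g g' : A ≃[L] A, (∀ p ∈ s, g (σ n p.1) = p.2) ∧
          g' ∘ w = fun o : Option s => o.elim (g (σ n x)) fun p => p.1.2 :=
        (eventually_all_finite hF).2 fun w hw => Ultrafilter.eventually_not.2 fun hn => hno ⟨w, hw, hn⟩
      obtain ⟨n, ⟨w, hw, hn⟩, hn'⟩ := (h₁.and this).exists
      exact hn' w hw hn
    obtain ⟨w, -, hw⟩ := h₂
    obtain ⟨n₀, g₀, g₀', -, hg₀'⟩ := hw.exists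
    refine ⟨g₀ (σ n₀ x), insert (x, g₀ (σ n₀ x)) s, Finset.subset_insert _ _,
      Finset.mem_insert_self _ _, ?_⟩
    filter_upwards [hw]
    rintro n ⟨g, g', hg, hg'⟩
    refine ⟨(g₀'.comp g'.symm).comp g, fun p hp => ?_⟩
    have hmove : ∀ o : Option s,
        g₀' (g'.symm (o.elim (g (σ n x)) fun p => p.1.2)) = o.elim (g₀ (σ n₀ x)) fun p => p.1.2 := by
      intro o
      rw [← congrFun hg' o, ← congrFun hg₀' o]
      simp
    obtain rfl | hp := Finset.mem_insert.1 hp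
    · exact hmove none
    · have := hmove (some ⟨p, hp⟩)
      simp only [Option.elim] at this
      simp only [Language.Equiv.comp_apply, hg p hp, this]
  obtain ⟨ρ, -, hρ⟩ := exists_hom_of_forth (L := L) P ∅
    (Eventually.of_forall fun n => ⟨.refl L A, by simp⟩) hP hext
  refine ⟨ρ, fun S => ?_⟩
  obtain ⟨t, ht, hSt⟩ := hρ S
  filter_upwards [ht]
  rintro n ⟨g, hg⟩
  exact ⟨g, fun x hx => hg _ (hSt x hx)⟩

end Oligomorphic

/-! ### Continuous homomorphisms between endomorphism monoids -/

section Topology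

variable {L : Language} {A : Type*} [L.Structure A]

theorem isOpen_setOf_apply_eq (b c : A) : IsOpen {σ : A →[L] A | σ b = c} := by
  let _ : TopologicalSpace A := ⊥
  have : DiscreteTopology A := ⟨rfl⟩
  refine isOpen_induced_iff.2 ⟨{s : A → A | s b = c}, ?_, rfl⟩
  exact (continuous_apply (A := fun _ : A => A) b).isOpen_preimage {c} (isOpen_discrete _)

/-- Basic neighbourhoods are given by the values at finitely many points. -/
theorem exists_finset_forall_mem {U : Set (A →[L] A)} (hU : IsOpen U) {σ : A →[L] A}
    (hσ : σ ∈ U) : ∃ S : Finset A, ∀ τ : A →[L] A, (∀ x ∈ S, τ x = σ x) → τ ∈ U := by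
  let _ : TopologicalSpace A := ⊥
  have : DiscreteTopology A := ⟨rfl⟩
  obtain ⟨V, hV, rfl⟩ := isOpen_induced_iff.1 hU
  obtain ⟨S, u, hu, hSu⟩ := isOpen_pi_iff.1 hV _ hσ
  refine ⟨S, fun τ hτ => hSu fun x hx => ?_⟩
  change τ x ∈ u x
  rw [hτ x hx]
  exact (hu x hx).2

theorem isOpen_of_forall_exists_finset {U : Set (A →[L] A)}
    (h : ∀ σ ∈ U, ∃ S : Finset A, ∀ τ : A →[L] A, (∀ x ∈ S, τ x = σ x) → τ ∈ U) :
    IsOpen U := by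
  refine isOpen_iff_forall_mem_open.2 fun σ hσ => ?_
  obtain ⟨S, hS⟩ := h σ hσ
  refine ⟨⋂ x ∈ S, {τ : A →[L] A | τ x = σ x}, fun τ hτ => hS τ ?_,
    isOpen_biInter_finset fun x _ => isOpen_setOf_apply_eq x _, ?_⟩
  · simpa using hτ
  · simp

theorem continuous_of_forall_exists_finset {L' : Language} {B : Type*} [L'.Structure B]
    {f : (A →[L] A) → (B →[L'] B)}
    (h : ∀ b, ∃ S : Finset A, ∀ σ τ : A →[L] A, (∀ x ∈ S, τ x = σ x) → f τ b = f σ b) :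
    Continuous f := by
  classical
  refine ⟨fun U hU => isOpen_of_forall_exists_finset fun σ hσ => ?_⟩
  obtain ⟨T, hT⟩ := exists_finset_forall_mem hU hσ
  choose S hS using h
  exact ⟨T.biUnion S, fun τ hτ => hT _ fun b hb => hS b σ τ fun x hx =>
    hτ x (Finset.mem_biUnion.2 ⟨b, hb, hx⟩)⟩

end Topology

section Continuous

variable {L L' : Language} {A B : Type*} [L.Structure A] [L'.Structure B]

theorem map_toHom_injective (f : (A →[L] A) →* (B →[L'] B)) (g : A ≃[L] A) :
    Function.Injective (f g.toHom) := by
  have hinv : f g.symm.toHom * f g.toHom = 1 := by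
    rw [← map_mul, ← map_one f]
    congr 1
    ext x
    exact g.symm_apply_apply x
  intro x y hxy
  have key : ∀ z, f g.symm.toHom (f g.toHom z) = z := fun z => DFunLike.congr_fun hinv z
  rw [← key x, hxy, key]

/-- **Uniform continuity.** The value of `f σ` at a point `b` depends only on the restriction of
`σ` to a finite set that is independent of `σ`. Otherwise the endomorphisms violating this would
have, up to automorphisms, a limit at which `f` fails to be continuous. -/
theorem Oligomorphic.exists_finset_determining [Countable A] (h : Oligomorphic L A)
    {f : (A →[L] A) →* (B →[L'] B)} (hf : Continuous f) (b : B) :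
    ∃ S : Finset A, ∀ σ τ : A →[L] A, (∀ x ∈ S, σ x = τ x) → f σ b = f τ b := by
  classical
  by_contra! hno
  choose σ τ hστ hne using hno
  let u : Ultrafilter (Finset A) := Ultrafilter.of Filter.atTop
  have hu : (u : Filter (Finset A)) ≤ Filter.atTop := Ultrafilter.of_le _
  obtain ⟨ρ, hρ⟩ := h.exists_limit u σ
  obtain ⟨S, hS⟩ := exists_finset_forall_mem
    ((isOpen_setOf_apply_eq b (f ρ b)).preimage hf) (σ := ρ) rfl
  obtain ⟨T, ⟨g, hg⟩, hST⟩ := ((hρ S).and (hu (Filter.mem_atTop S))).exists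
  have h₁ : f (g.toHom * σ T) b = f ρ b := hS _ fun x hx => hg x hx
  have h₂ : f (g.toHom * τ T) b = f ρ b := hS _ fun x hx => by
    change g (τ T x) = ρ x
    rw [← hστ T x (hST hx), hg x hx]
  rw [map_mul] at h₁ h₂
  exact hne T (map_toHom_injective f g (h₁.trans h₂.symm))

/-- A non-contractible countable oligomorphic structure has a finite subset on which no
endomorphism is constant. -/
theorem Oligomorphic.exists_finset_not_constant [Countable A] [Nonempty A] (h : Oligomorphic L A)
    (hnc : ¬ Contractible L A) :
    ∃ S : Finset A, ∀ (σ : A →[L] A) (c : A), ∃ x ∈ S, σ x ≠ c := by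
  classical
  by_contra! hno
  choose σ c hσ using hno
  let u : Ultrafilter (Finset A) := Ultrafilter.of Filter.atTop
  have hu : (u : Filter (Finset A)) ≤ Filter.atTop := Ultrafilter.of_le _
  obtain ⟨ρ, hρ⟩ := h.exists_limit u σ
  obtain ⟨a⟩ := ‹Nonempty A›
  refine hnc ⟨ρ, ρ a, fun x => ?_⟩
  obtain ⟨T, ⟨g, hg⟩, hT⟩ := ((hρ {x, a}).and (hu (Filter.mem_atTop {x, a}))).exists
  have hT' : ∀ y ∈ ({x, a} : Finset A), σ T y = c T := fun y hy => hσ T y (hT hy)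
  rw [← hg x (by simp), ← hg a (by simp), hT' x (by simp), hT' a (by simp)]

theorem CoveredByFinitelyManyOrbits.mono {S T : Set (B →[L'] B)} (hST : S ⊆ T)
    (h : CoveredByFinitelyManyOrbits S) : CoveredByFinitelyManyOrbits T := by
  obtain ⟨F, hF, hcov⟩ := h
  refine ⟨F, hF, Set.eq_univ_of_univ_subset (hcov ▸ Set.iUnion₂_mono fun m _ => ?_)⟩
  rintro _ ⟨σ, hσ, rfl⟩
  exact ⟨σ, hST hσ, rfl⟩

/-- An orbit of the image of `f` splits into finitely many orbits of the image of the automorphism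
group, because the value at its base point is determined by the image of a finite tuple. -/
theorem Oligomorphic.coveredByFinitelyManyOrbits_iff [Countable A] (h : Oligomorphic L A)
    {f : (A →[L] A) →* (B →[L'] B)} (hf : Continuous f) :
    CoveredByFinitelyManyOrbits (Set.range f) ↔
      CoveredByFinitelyManyOrbits (f '' autSet L A) := by
  refine ⟨fun hB => ?_, fun hB => hB.mono (Set.image_subset_range _ _)⟩
  obtain ⟨F, hF, hcov⟩ := hB
  choose S hS using h.exists_finset_determining hf
  have key : ∀ b : B, ∃ E : Set B, E.Finite ∧
      ∀ σ : A →[L] A, ∃ m ∈ E, f σ b ∈ orbit (f '' autSet L A) m := by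
    intro b
    obtain ⟨E, hE, hcovE⟩ := h.exists_finite (S b)
    -- For each orbit of tuples, pick one endomorphism moving the determining tuple into it.
    have : ∀ w : S b → A, ∃ m : B, ∀ σ : A →[L] A, (∃ g : A ≃[L] A, g ∘ w = fun x : S b => σ x) →
        f σ b ∈ orbit (f '' autSet L A) m := by
      intro w
      by_cases hw : ∃ (σ : A →[L] A) (g : A ≃[L] A), g ∘ w = fun x : S b => σ x
      · obtain ⟨σ₀, g₀, hg₀⟩ := hw
        refine ⟨f σ₀ b, fun σ hσ => ?_⟩
        obtain ⟨g, hg⟩ := hσ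
        refine ⟨_, ⟨_, ⟨g.comp g₀.symm, rfl⟩, rfl⟩, ?_⟩
        change (f (g.comp g₀.symm).toHom * f σ₀) b = _
        rw [← map_mul]
        refine hS b _ _ fun x hx => ?_
        change g (g₀.symm (σ₀ x)) = σ x
        rw [← congrFun hg₀ ⟨x, hx⟩, ← congrFun hg ⟨x, hx⟩]
        simp
      · exact ⟨b, fun σ hσ => (hw ⟨σ, hσ⟩).elim⟩
    choose m hm using this
    refine ⟨m '' E, hE.image m, fun σ => ?_⟩
    obtain ⟨w, hw, hg⟩ := hcovE fun x : S b => σ x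
    exact ⟨m w, ⟨w, hw, rfl⟩, hm w σ hg⟩
  choose E hE hEcov using key
  refine ⟨⋃ b ∈ F, E b, hF.biUnion fun b _ => hE b, Set.eq_univ_of_forall fun x => ?_⟩
  obtain ⟨b, hb, _, ⟨σ, rfl⟩, rfl⟩ := Set.mem_iUnion₂.1 (hcov ▸ Set.mem_univ x)
  obtain ⟨m, hm, hx⟩ := hEcov b σ
  exact Set.mem_iUnion₂.2 ⟨m, Set.mem_iUnion₂.2 ⟨b, hb, hm⟩, hx⟩

end Continuous

/-! ### Interpretations and continuous homomorphisms -/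

section Interpretation

variable {L L' : Language} {A B : Type*} [L.Structure A] [L'.Structure B]

theorem IsBasicSet.comp_mem {k : ℕ} {X : Set (Fin k → B)} (hX : IsBasicSet L' B k X)
    (σ : B →[L'] B) {v : Fin k → B} (hv : v ∈ X) : σ ∘ v ∈ X := by
  obtain _ | _ | R | f := hX
  · trivial
  · exact congrArg σ hv
  · exact σ.map_rel R v hv
  · exact (σ.map_fun f _).symm.trans (congrArg σ hv)

/-- Endomorphisms act on the domain of a positive existential interpretation, hence on the
interpreted structure. -/
theorem PosExInterpretable.exists_continuous_hom (h : Oligomorphic L A)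
    (hI : PosExInterpretable L A L' B) :
    ∃ f : (A →[L] A) →* (B →[L'] B), Continuous f ∧
      CoveredByFinitelyManyOrbits (f '' autSet L A) := by
  classical
  obtain ⟨d, U, i, hi, hdef⟩ := hI
  have hU : ∀ (σ : A →[L] A) (u : Fin d → A), u ∈ U → σ ∘ u ∈ U := by
    intro σ u hu
    obtain ⟨h', -⟩ := (hdef 1 _ .universe).comp_mem σ
      (v := fun p : Fin 1 × Fin d => u p.2) ⟨fun _ => hu, trivial⟩
    exact h' 0
  let act : (A →[L] A) → U → U := fun σ u => ⟨σ ∘ u.1, hU σ _ u.2⟩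
  have hact : ∀ {k : ℕ} {X : Set (Fin k → B)}, IsBasicSet L' B k X → ∀ (σ : A →[L] A)
      (u : Fin k → U), (fun j => i (u j)) ∈ X → (fun j => i (act σ (u j))) ∈ X := by
    intro k X hX σ u hu
    obtain ⟨_, h'⟩ := (hdef k X hX).comp_mem σ
      (v := fun p : Fin k × Fin d => (u p.1).1 p.2) ⟨fun j => (u j).2, hu⟩
    exact h'
  let inv : B → U := Function.surjInv hi
  have hinv : ∀ b, i (inv b) = b := Function.surjInv_eq hi
  have hwd : ∀ σ u, i (act σ (inv (i u))) = i (act σ u) := fun σ u =>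
    hact .diagonal σ ![inv (i u), u] (hinv (i u))
  let F : (A →[L] A) → (B →[L'] B) := fun σ =>
    { toFun := fun b => i (act σ (inv b))
      map_fun' := fun {n} s x => by
        have := hact (.graph s) σ
          (Fin.snoc (α := fun _ => U) (inv ∘ x) (inv (Language.Structure.funMap s x)))
          (by simp [hinv])
        simpa [Function.comp_def] using this.symm
      map_rel' := fun {n} R x hx =>
        hact (.relation R) σ (inv ∘ x) (by simpa [hinv, Function.comp_def] using hx) }
  have hF : ∀ σ u, F σ (i u) = i (act σ u) := hwd
  let f : (A →[L] A) →* (B →[L'] B) :=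
    { toFun := F
      map_one' := Language.Hom.ext fun b => hinv b
      map_mul' := fun σ τ => Language.Hom.ext fun b => (hF σ (act τ (inv b))).symm }
  refine ⟨f, continuous_of_forall_exists_finset fun b =>
    ⟨Finset.univ.image (inv b).1, fun σ τ hστ => ?_⟩, ?_⟩
  · change i (act τ (inv b)) = i (act σ (inv b))
    congr 1
    exact Subtype.ext (funext fun t => hστ _ (Finset.mem_image_of_mem _ (Finset.mem_univ t)))
  · obtain ⟨E, hE, hcov⟩ := h d
    refine ⟨i '' (Subtype.val ⁻¹' E), (hE.preimage Subtype.val_injective.injOn).image i,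
      Set.eq_univ_of_forall fun b => ?_⟩
    obtain ⟨w, hw, g, hg⟩ := hcov (inv b).1
    have hwU : w ∈ U := by
      have := hU g.symm.toHom _ (inv b).2
      rw [← hg] at this
      convert this
      funext t
      simp
    refine Set.mem_iUnion₂.2 ⟨i ⟨w, hwU⟩, ⟨⟨w, hwU⟩, hw, rfl⟩, f g.toHom, ⟨_, ⟨g, rfl⟩, rfl⟩, ?_⟩
    calc F g.toHom (i ⟨w, hwU⟩) = i (act g.toHom ⟨w, hwU⟩) := hF _ _
      _ = i (inv b) := congrArg i (Subtype.ext hg)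
      _ = b := hinv b

/-- If `B` is covered by the orbits of finitely many points `b` carrying `d`-tuples `e b` of `A`
such that `σ (e b)` determines `f σ b`, also among different points, then `σ (e b) ↦ f σ b`
interprets `B` in `A`. -/
theorem Oligomorphic.posExInterpretable_of_tuples [Countable A] (h : Oligomorphic L A)
    (f : (A →[L] A) →* (B →[L'] B)) {F : Set B}
    (hcov : (⋃ m ∈ F, orbit (Set.range f) m) = Set.univ) {d : ℕ} (e : F → Fin d → A)
    (he : ∀ (b b' : F) (σ τ : A →[L] A), σ ∘ e b = τ ∘ e b' → f σ b = f τ b') :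
    PosExInterpretable L A L' B := by
  let U : Set (Fin d → A) := {u | ∃ (b : F) (σ : A →[L] A), σ ∘ e b = u}
  choose pt hom hhom using fun u : U => u.2
  let i : U → B := fun u => f (hom u) (pt u)
  have hi : ∀ (u : U) (b : F) (σ : A →[L] A), σ ∘ e b = u.1 → i u = f σ b :=
    fun u b σ hσ => he _ _ _ _ ((hhom u).trans hσ.symm)
  refine ⟨d, U, i, fun x => ?_, fun k X hX => h.posExDefinable fun ρ y hy => ?_⟩
  · obtain ⟨b, hb, _, ⟨σ, rfl⟩, rfl⟩ := Set.mem_iUnion₂.1 (hcov ▸ Set.mem_univ x)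
    exact ⟨⟨_, ⟨b, hb⟩, σ, rfl⟩, hi _ ⟨b, hb⟩ σ rfl⟩
  · obtain ⟨hyU, hyX⟩ := hy
    have hρ : ∀ u : U, (ρ * hom u) ∘ e (pt u) = ρ ∘ u.1 := fun u => by
      rw [← hhom u]; rfl
    refine ⟨fun j => ⟨_, _, hρ ⟨_, hyU j⟩⟩, ?_⟩
    convert hX.comp_mem (f ρ) hyX using 1
    funext j
    rw [hi _ _ _ (hρ ⟨_, hyU j⟩), map_mul]
    rfl

/-- Non-contractibility provides the tuples: the finite set `T` on which no endomorphism is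
constant serves to mark the base point to which an image belongs. -/
theorem Oligomorphic.posExInterpretable [Countable A] [Nonempty A] (h : Oligomorphic L A)
    (hnc : ¬ Contractible L A) {f : (A →[L] A) →* (B →[L'] B)} (hf : Continuous f)
    (hB : CoveredByFinitelyManyOrbits (Set.range f)) : PosExInterpretable L A L' B := by
  classical
  obtain ⟨F, hF, hcov⟩ := hB
  have : Fintype F := hF.fintype
  obtain ⟨T₀, hT₀⟩ := h.exists_finset_not_constant hnc
  choose S hS using h.exists_finset_determining hf
  let T : Finset A := T₀ ∪ Finset.univ.biUnion fun b : F => S b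
  obtain ⟨d, ⟨ε⟩⟩ := Finite.exists_equiv_fin (F × T)
  obtain ⟨a⟩ := ‹Nonempty A›
  -- The block of `e b` with index `b'` enumerates `T` if `b' = b`, and is constant otherwise.
  let e : F → Fin d → A := fun b t => if (ε.symm t).1 = b then (ε.symm t).2 else a
  have heval : ∀ (b b' : F) (x : T), e b (ε (b', x)) = if b' = b then (x : A) else a := by
    intro b b' x
    simp [e]
  refine h.posExInterpretable_of_tuples f hcov e fun b b' σ τ hστ => ?_
  have hblock : ∀ x : T, σ x = τ (if b = b' then (x : A) else a) := by
    intro x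
    have := congrFun hστ (ε (b, x))
    simpa only [Function.comp_apply, heval, if_true] using this
  by_cases hbb : b = b'
  · subst hbb
    refine hS b σ τ fun x hx => ?_
    simpa using hblock ⟨x, Finset.mem_union_right _
      (Finset.mem_biUnion.2 ⟨b, Finset.mem_univ b, hx⟩)⟩
  · obtain ⟨x, hx, hne⟩ := hT₀ σ (τ a)
    exact (hne (by simpa [hbb] using hblock ⟨x, Finset.mem_union_left _ hx⟩)).elim

end Interpretation

/-! ### The Ryll-Nardzewski theorem -/

section RyllNardzewski

variable {L : Language} {A : Type w} [L.Structure A] {α β : Type*}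

variable (L) in
/-- The tuple `v` satisfies a formula that isolates its type, that is, `v` lies in a least
`∅`-definable set. -/
def IsIsolated (v : α → A) : Prop :=
  ∃ X : Set (α → A), (∅ : Set A).Definable L X ∧ v ∈ X ∧
    ∀ Z, (∅ : Set A).Definable L Z → v ∈ Z → X ⊆ Z

theorem IsIsolated.comp [Finite α] [Finite β] {v : α → A} (h : IsIsolated L v) (g : β → α) :
    IsIsolated L (v ∘ g) := by
  obtain ⟨X, hX, hv, hmin⟩ := h
  exact ⟨_, hX.image_comp g, ⟨v, hv, rfl⟩, fun Z hZ hvZ =>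
    Set.image_subset_iff.2 (hmin _ (hZ.preimage_comp g) hvZ)⟩

/-- Countable structures elementarily equivalent to an `ℵ₀`-categorical one are isomorphic
to it. -/
theorem nonempty_equiv_of_categorical [Infinite A] [Countable A]
    (hcat : (ℵ₀ : Cardinal.{w}).Categorical (L.completeTheory A)) (N : Type w) [L.Structure N]
    [Countable N] (hN : A ≅[L] N) : Nonempty (N ≃[L] A) := by
  have : Infinite N := hN.infinite
  have : N ⊨ L.completeTheory A := hN.theory_model
  exact hcat (.of _ N) (.of _ A) (mk_eq_aleph0 N) (mk_eq_aleph0 A)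

/-- A decreasing sequence of nonempty definable sets of finite tuples has a common point: it has
one in an ultrapower, which may be moved into `A` along a countable elementary submodel. -/
theorem exists_forall_mem_of_antitone [Infinite A] [Countable A]
    [Countable L.Symbols] [Finite α]
    (hcat : (ℵ₀ : Cardinal.{w}).Categorical (L.completeTheory A))
    (D : ℕ → Set (α → A)) (hD : Antitone D)
    (hdef : ∀ k, (∅ : Set A).Definable L (D k)) (hne : ∀ k, (D k).Nonempty) :
    ∃ v, ∀ k, v ∈ D k := by
  choose a ha using hne
  choose φ hφ using fun k => Set.empty_definable_iff.1 (hdef k)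
  let u : Ultrafilter ℕ := Filter.hyperfilter ℕ
  let N := (u : Filter ℕ).Product fun _ => A
  let x : α → N := fun i => ((fun k => a k i : ℕ → A) : (u : Filter ℕ).Product fun _ => A)
  have hx : ∀ k, (φ k).Realize x := fun k => by
    refine (Language.Ultraproduct.realize_formula_cast (φ k) fun i k => a k i).2 ?_
    have : ∀ᶠ j in (u : Filter ℕ), k ≤ j :=
      Nat.hyperfilter_le_atTop (Filter.eventually_ge_atTop k)
    filter_upwards [this] with j hj
    have := hD hj (ha j)
    rwa [hφ k] at this
  have hAN : A ≅[L] N := Language.elementarilyEquivalent_iff.2 fun ψ => by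
    rw [Language.Ultraproduct.sentence_realize, Filter.eventually_const]
  have : Infinite N := hAN.infinite
  obtain ⟨S, hxS, hcard⟩ := Language.exists_elementarySubstructure_card_eq (L := L)
    (Set.range x) (ℵ₀ : Cardinal.{w}) le_rfl
    (by simp [(Set.finite_range x).countable.le_aleph0])
    (by
      rw [lift_aleph0, lift_le_aleph0]
      exact mk_le_aleph0_iff.2 ‹Countable L.Symbols›) (by simp)
  have : Countable S := mk_le_aleph0_iff.1 (by simpa using hcard.le)
  obtain ⟨e⟩ := nonempty_equiv_of_categorical hcat S (hAN.trans S.elementarilyEquivalent.symm)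
  let y : α → S := fun i => ⟨x i, hxS ⟨i, rfl⟩⟩
  refine ⟨e ∘ y, fun k => ?_⟩
  rw [hφ k]
  change (φ k).Realize (e ∘ y)
  rw [Language.StrongHomClass.realize_formula e (φ k), ← S.subtype.map_formula]
  exact hx k

/-- Isolated tuples are dense: otherwise a decreasing sequence of nonempty definable sets could
avoid, one by one, all of the countably many tuples. -/
theorem exists_minimal_definable [Infinite A] [Countable A]
    [Countable L.Symbols] [Finite α]
    (hcat : (ℵ₀ : Cardinal.{w}).Categorical (L.completeTheory A))
    {X : Set (α → A)} (hX : (∅ : Set A).Definable L X) (hne : X.Nonempty) :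
    ∃ Y ⊆ X, (∅ : Set A).Definable L Y ∧ Y.Nonempty ∧
      ∀ Z, (∅ : Set A).Definable L Z → (Z ∩ Y).Nonempty → Y ⊆ Z := by
  by_contra hno
  let P := {Y : Set (α → A) // Y ⊆ X ∧ (∅ : Set A).Definable L Y ∧ Y.Nonempty}
  have hstep : ∀ (v : α → A) (Y : P), ∃ Y' : P, Y'.1 ⊆ Y.1 ∧ v ∉ Y'.1 := by
    rintro v ⟨Y, hYX, hY, y, hy⟩
    have : ∃ Z, (∅ : Set A).Definable L Z ∧ (Z ∩ Y).Nonempty ∧ ¬ Y ⊆ Z := by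
      by_contra! hno'
      exact hno ⟨Y, hYX, hY, ⟨y, hy⟩, hno'⟩
    obtain ⟨Z, hZ, hZY, hYZ⟩ := this
    by_cases hv : v ∈ Z
    · obtain ⟨z, hz, hzZ⟩ := Set.not_subset.1 hYZ
      exact ⟨⟨Y \ Z, Set.sdiff_subset.trans hYX, hY.sdiff hZ, z, hz, hzZ⟩, Set.sdiff_subset,
        fun h => h.2 hv⟩
    · exact ⟨⟨Z ∩ Y, Set.inter_subset_right.trans hYX, hZ.inter hY, hZY⟩,
        Set.inter_subset_right, fun h => hv h.1⟩
  choose next hnext using hstep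
  have : Nonempty (α → A) := hne.to_type
  obtain ⟨enum, henum⟩ := exists_surjective_nat (α → A)
  let D : ℕ → P := fun k => Nat.rec ⟨X, subset_rfl, hX, hne⟩ (fun k Y => next (enum k) Y) k
  obtain ⟨v, hv⟩ := exists_forall_mem_of_antitone hcat (fun k => (D k).1)
    (antitone_nat_of_succ_le fun k => (hnext (enum k) (D k)).1) (fun k => (D k).2.2.1)
    (fun k => (D k).2.2.2)
  obtain ⟨k, rfl⟩ := henum v
  exact (hnext (enum k) (D k)).2 (hv (k + 1))

/-- A definable condition on one further coordinate that can be satisfied over an isolated tuple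
can be satisfied so that the longer tuple is isolated. -/
theorem IsIsolated.exists_option [Infinite A] [Countable A]
    [Countable L.Symbols] [Finite α]
    (hcat : (ℵ₀ : Cardinal.{w}).Categorical (L.completeTheory A))
    {v : α → A} (h : IsIsolated L v) {Y : Set (Option α → A)} (hY : (∅ : Set A).Definable L Y)
    {a : A} (ha : (fun o => o.elim a v : Option α → A) ∈ Y) :
    ∃ b, (fun o => o.elim b v : Option α → A) ∈ Y ∧
      IsIsolated L (fun o => o.elim b v : Option α → A) := by
  obtain ⟨X, hX, hvX, hmin⟩ := h
  obtain ⟨W, hWY, hW, ⟨z, hzW⟩, hWmin⟩ := exists_minimal_definable hcat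
    (hY.inter (hX.preimage_comp some)) ⟨_, ha, hvX⟩
  have hvW : v ∈ (fun g : Option α → A => g ∘ some) '' W := by
    by_contra hv
    exact hmin _ (hW.image_comp some).compl hv (hWY hzW).2 ⟨z, hzW, rfl⟩
  obtain ⟨y, hy, hyv⟩ := hvW
  have hy' : (fun o => o.elim (y none) v : Option α → A) = y := by
    funext o
    cases o with
    | none => rfl
    | some o => exact (congrFun hyv o).symm
  refine ⟨y none, ?_, W, hW, ?_, fun Z hZ hyZ => hWmin Z hZ ⟨_, hyZ, ?_⟩⟩ <;> rw [hy']
  exacts [(hWY hy).1, hy, hy]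

theorem definable_realize {n : ℕ} (φ : L.BoundedFormula Empty n) :
    (∅ : Set A).Definable L {x : Fin n → A | φ.Realize default x} := by
  refine Set.empty_definable_iff.2 ⟨φ.toFormula.relabel (Sum.elim Empty.elim id), ?_⟩
  ext x
  change _ ↔ Language.Formula.Realize _ _
  rw [Language.Formula.realize_relabel, Language.BoundedFormula.realize_toFormula,
    Subsingleton.elim ((x ∘ Sum.elim Empty.elim id) ∘ Sum.inl) default]
  rfl

/-- An `ℵ₀`-categorical structure has an atomic elementary substructure, built generically from
finite sets whose enumerations are isolated. -/
theorem exists_atomic_elementarySubstructure [Infinite A] [Countable A] [Countable L.Symbols]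
    (hcat : (ℵ₀ : Cardinal.{w}).Categorical (L.completeTheory A)) :
    ∃ S : L.ElementarySubstructure A, ∀ s : Finset A, (s : Set A) ⊆ S →
      IsIsolated L fun p : s => (p : A) := by
  classical
  let P : Finset A → Prop := fun s => IsIsolated L fun p : s => (p : A)
  have hmono : ∀ {s t : Finset A}, s ⊆ t → P t → P s := fun hst ht =>
    ht.comp (Set.inclusion hst)
  have h₀ : P ∅ := ⟨Set.univ, Set.definable_univ, trivial, fun Z _ hZ z _ => by
    convert hZ using 1
    exact funext fun p => absurd p.2 (Finset.notMem_empty _)⟩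
  let ι := Σ n : ℕ, L.BoundedFormula Empty (n + 1) × (Fin n → A)
  have hcount : ∀ n, Countable (L.BoundedFormula Empty (n + 1)) := fun n =>
    (sigma_mk_injective (β := L.BoundedFormula Empty) (i := n + 1)).countable
  -- Requiring a witness over `x` as soon as `x` is compatible with the finite set makes the
  -- requirement persist when `x` is added at a later stage.
  let D : ι → Finset A → Prop := fun i s =>
    (∃ t, s ⊆ t ∧ P t ∧ ∀ j, i.2.2 j ∈ t) →
      (∃ a, i.2.1.Realize default (Fin.snoc (α := fun _ => A) i.2.2 a)) →
        ∃ b ∈ s, i.2.1.Realize default (Fin.snoc (α := fun _ => A) i.2.2 b)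
  have hD : ∀ i s, P s → ∃ t, s ⊆ t ∧ P t ∧ D i t := by
    rintro ⟨n, φ, x⟩ s hs
    by_cases h₁ : ∃ t, s ⊆ t ∧ P t ∧ ∀ j, x j ∈ t
    swap
    · exact ⟨s, subset_rfl, hs, fun h => (h₁ h).elim⟩
    by_cases h₂ : ∃ a, φ.Realize default (Fin.snoc (α := fun _ => A) x a)
    swap
    · exact ⟨s, subset_rfl, hs, fun _ h => (h₂ h).elim⟩
    obtain ⟨t, hst, ht, hxt⟩ := h₁
    obtain ⟨a, ha⟩ := h₂
    let g : Fin (n + 1) → Option t :=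
      Fin.snoc (α := fun _ => Option t) (fun j => some ⟨x j, hxt j⟩) none
    have hg : ∀ b : A, (fun o : Option t => o.elim b fun p => (p : A)) ∘ g =
        Fin.snoc (α := fun _ => A) x b := fun b => by
      rw [Fin.comp_snoc]
      rfl
    obtain ⟨b, hb, hiso⟩ := ht.exists_option hcat ((definable_realize φ).preimage_comp g) (a := a)
      (by simpa [hg] using ha)
    refine ⟨insert b t, hst.trans (Finset.subset_insert _ _), ?_, fun _ _ =>
      ⟨b, Finset.mem_insert_self _ _, by simpa [hg] using hb⟩⟩
    have hlift : ∀ p : (insert b t : Finset A), ∃ o : Option t, (o.elim b fun p => (p : A)) = p := by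
      rintro ⟨p, hp⟩
      obtain rfl | hp := Finset.mem_insert.1 hp
      exacts [⟨none, rfl⟩, ⟨some ⟨p, hp⟩, rfl⟩]
    choose r hr using hlift
    have := hiso.comp r
    rwa [show (fun o : Option t => o.elim b fun p => (p : A)) ∘ r =
      fun p : (insert b t : Finset A) => (p : A) from funext hr] at this
  obtain ⟨G, -, hfin, hmeet⟩ := exists_generic P ∅ h₀ D hD
  have htv : ∀ {n : ℕ} (φ : L.BoundedFormula Empty (n + 1)) (x : Fin n → A), (∀ j, x j ∈ G) →
      (∃ a, φ.Realize default (Fin.snoc (α := fun _ => A) x a)) →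
        ∃ b ∈ G, φ.Realize default (Fin.snoc (α := fun _ => A) x b) := by
    intro n φ x hx ha
    obtain ⟨s, -, hs, hsG⟩ := hmeet ⟨n, φ, x⟩
    obtain ⟨t, hst, ht, -⟩ := hfin (s ∪ Finset.univ.image x) (by
      simpa [Set.range_subset_iff] using ⟨hsG, hx⟩)
    obtain ⟨b, hb, hφ⟩ := hs ⟨t, Finset.union_subset_left hst, ht, fun j =>
      hst (Finset.mem_union_right _ (Finset.mem_image_of_mem _ (Finset.mem_univ j)))⟩ ha
    exact ⟨b, hsG hb, hφ⟩
  let S : L.Substructure A :=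
    { carrier := G
      fun_mem := fun {n} f x hx => by
        obtain ⟨b, hb, hfb⟩ := htv
          ((Language.Term.func f fun j => .var (Sum.inr j.castSucc)).bdEqual
            (.var (Sum.inr (Fin.last n)))) x hx ⟨Language.Structure.funMap f x, by simp⟩
        have : Language.Structure.funMap f x = b := by simpa using hfb
        rwa [this] }
  refine ⟨S.toElementarySubstructure fun n φ x a ha => ?_, fun s hs => ?_⟩
  · obtain ⟨b, hb, hφ⟩ := htv φ (fun j => (x j : A)) (fun j => (x j).2) ⟨a, ha⟩
    exact ⟨⟨b, hb⟩, hφ⟩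
  · obtain ⟨t, hst, ht, -⟩ := hfin s hs
    exact hmono hst ht

/-- Every finite tuple of an `ℵ₀`-categorical structure is isolated, since the structure is
isomorphic to an atomic elementary substructure of itself. -/
theorem isIsolated_of_categorical [Infinite A] [Countable A] [Countable L.Symbols] [Finite α]
    (hcat : (ℵ₀ : Cardinal.{w}).Categorical (L.completeTheory A)) (v : α → A) :
    IsIsolated L v := by
  classical
  have := Fintype.ofFinite α
  obtain ⟨S, hS⟩ := exists_atomic_elementarySubstructure hcat
  obtain ⟨e⟩ := nonempty_equiv_of_categorical hcat S S.elementarilyEquivalent.symm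
  let ε : A ↪ₑ[L] A := S.subtype.comp e.symm.toElementaryEmbedding
  have hε : IsIsolated L (ε ∘ v) := by
    have := hS (Finset.univ.image (ε ∘ v)) (by
      intro a ha
      obtain ⟨i, -, rfl⟩ := Finset.mem_image.1 ha
      exact (e.symm (v i)).2)
    exact this.comp fun i => ⟨ε (v i), Finset.mem_image_of_mem _ (Finset.mem_univ i)⟩
  obtain ⟨X, hX, hvX, hmin⟩ := hε
  obtain ⟨θ, rfl⟩ := Set.empty_definable_iff.1 hX
  refine ⟨_, Set.empty_definable_iff.2 ⟨θ, rfl⟩, (ε.map_formula θ v).1 hvX, fun Z hZ hvZ u hu => ?_⟩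
  obtain ⟨ψ, rfl⟩ := Set.empty_definable_iff.1 hZ
  exact (ε.map_formula ψ u).1 (hmin _ hZ ((ε.map_formula ψ v).2 hvZ)
    ((ε.map_formula θ u).2 hu))

variable (L) in
/-- Every first-order property of the tuple `v` is shared by the tuple `u`. -/
def DefinableLE (v u : α → A) : Prop :=
  ∀ Z : Set (α → A), (∅ : Set A).Definable L Z → v ∈ Z → u ∈ Z

theorem DefinableLE.symm {v u : α → A} (h : DefinableLE L v u) : DefinableLE L u v :=
  fun _ hZ hu => by_contra fun hv => h _ hZ.compl hv hu

theorem DefinableLE.comp {v u : α → A} (h : DefinableLE L v u) (g : β → α) :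
    DefinableLE L (v ∘ g) (u ∘ g) :=
  fun _ hZ hv => h _ (hZ.preimage_comp g) hv

/-- If all tuples are isolated, there are only finitely many types of `α`-tuples: otherwise the
complements of the isolating sets would have a common point. -/
theorem exists_finite_definableLE [Infinite A] [Countable A] [Countable L.Symbols] [Finite α]
    (hcat : (ℵ₀ : Cardinal.{w}).Categorical (L.completeTheory A)) :
    ∃ F : Set (α → A), F.Finite ∧ ∀ v, ∃ u ∈ F, DefinableLE L u v := by
  choose X hX hvX hmin using isIsolated_of_categorical (α := α) hcat
  obtain ⟨enum, henum⟩ := exists_surjective_nat (α → A)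
  let D : ℕ → Set (α → A) := fun k => (⋃ j ∈ Finset.range k, X (enum j))ᶜ
  have hD : ∃ k, ¬ (D k).Nonempty := by
    by_contra! hne
    obtain ⟨v, hv⟩ := exists_forall_mem_of_antitone hcat D
      (fun k l hkl => Set.compl_subset_compl.2 (Set.biUnion_subset_biUnion_left
        (Finset.range_subset_range.2 hkl)))
      (fun k => (Set.definable_biUnion_finset (fun j => hX (enum j)) _).compl) hne
    obtain ⟨j, rfl⟩ := henum v
    exact hv (j + 1) (Set.mem_iUnion₂.2 ⟨j, Finset.self_mem_range_succ j, hvX _⟩)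
  obtain ⟨k, hk⟩ := hD
  refine ⟨enum '' (Finset.range k), (Finset.finite_toSet _).image _, fun v => ?_⟩
  have hv : v ∉ D k := fun hv => hk ⟨v, hv⟩
  obtain ⟨j, hj, hvj⟩ := Set.mem_iUnion₂.1 (not_not.1 hv)
  exact ⟨enum j, ⟨j, hj, rfl⟩, fun Z hZ hjZ => hmin _ Z hZ hjZ hvj⟩

variable (L) in
/-- A finite set of pairs, seen as a partial map, preserves all first-order properties. -/
def IsPartialElementary (s : Finset (A × A)) : Prop :=
  DefinableLE L (fun p : s => p.1.1) (fun p : s => p.1.2)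

theorem isPartialElementary_of_definableLE {s : Finset (A × A)} {v u : α → A}
    (h : DefinableLE L v u) (hs : ∀ p ∈ s, ∃ i, (v i, u i) = p) : IsPartialElementary L s := by
  choose g hg using fun p : s => hs p.1 p.2
  have h' := h.comp g
  rwa [show v ∘ g = fun p : s => p.1.1 from funext fun p => congrArg Prod.fst (hg p),
    show u ∘ g = fun p : s => p.1.2 from funext fun p => congrArg Prod.snd (hg p)] at h'

theorem IsPartialElementary.isPartialHom {s : Finset (A × A)} (h : IsPartialElementary L s) :
    IsPartialHom L s :=
  fun _ hZ => h _ hZ.definable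

theorem IsPartialElementary.image_swap [DecidableEq A] {s : Finset (A × A)}
    (h : IsPartialElementary L s) : IsPartialElementary L (s.image Prod.swap) := by
  refine isPartialElementary_of_definableLE (DefinableLE.symm h) fun p hp => ?_
  obtain ⟨q, hq, rfl⟩ := Finset.mem_image.1 hp
  exact ⟨⟨q, hq⟩, rfl⟩

/-- Forth: a partial elementary map extends to any further argument. -/
theorem IsPartialElementary.exists_insert [DecidableEq A]
    (hiso : ∀ {β : Type w} [Finite β] (v : β → A), IsIsolated L v)
    {s : Finset (A × A)} (h : IsPartialElementary L s) (x : A) :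
    ∃ y, IsPartialElementary L (insert (x, y) s) := by
  obtain ⟨X, hX, hxX, hmin⟩ := hiso fun o : Option s => o.elim x fun p => p.1.1
  obtain ⟨z, hz, hzs⟩ := h _ (hX.image_comp some) ⟨_, hxX, rfl⟩
  refine ⟨z none, isPartialElementary_of_definableLE
    (v := fun o : Option s => o.elim x fun p => p.1.1) (u := z)
    (fun Z hZ hxZ => hmin Z hZ hxZ hz) fun p hp => ?_⟩
  obtain rfl | hp := Finset.mem_insert.1 hp
  · exact ⟨none, rfl⟩
  · exact ⟨some ⟨p, hp⟩, Prod.ext rfl (congrFun hzs ⟨p, hp⟩)⟩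

/-- Back and forth: in a countable structure all of whose tuples are isolated, tuples of the same
type are conjugate under an automorphism. -/
theorem DefinableLE.exists_equiv [Countable A] [Finite α]
    (hiso : ∀ {β : Type w} [Finite β] (v : β → A), IsIsolated L v)
    {v u : α → A} (h : DefinableLE L v u) : ∃ g : A ≃[L] A, g ∘ v = u := by
  classical
  have := Fintype.ofFinite α
  obtain ⟨G, ⟨t₀, hst₀, -, ht₀⟩, hfin, hmeet⟩ := exists_generic (IsPartialElementary L)
    (Finset.univ.image fun i => (v i, u i)) (isPartialElementary_of_definableLE h (by simp))
    (fun (z : A ⊕ A) t => z.elim (fun x => ∃ y, (x, y) ∈ t) fun y => ∃ x, (x, y) ∈ t) (by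
      rintro (x | y) s hs
      · obtain ⟨y, hy⟩ := hs.exists_insert hiso x
        exact ⟨_, Finset.subset_insert _ _, hy, y, Finset.mem_insert_self _ _⟩
      · obtain ⟨x, hx⟩ := hs.image_swap.exists_insert hiso y
        refine ⟨insert (x, y) s, Finset.subset_insert _ _, ?_, x, Finset.mem_insert_self _ _⟩
        have := hx.image_swap
        rwa [Finset.image_insert, Finset.image_image, Prod.swap_swap_eq, Finset.image_id] at this)
  obtain ⟨ρ, hρ⟩ := exists_hom_of_graph (L := L) (G := G)
    (fun x => by
      obtain ⟨t, -, ⟨y, hy⟩, htG⟩ := hmeet (.inl x)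
      exact ⟨y, htG hy⟩)
    (fun s hs => by
      obtain ⟨t, hst, ht, -⟩ := hfin s hs
      exact ⟨t, hst, ht.isPartialHom⟩)
  obtain ⟨τ, hτ⟩ := exists_hom_of_graph (L := L) (G := Prod.swap ⁻¹' G)
    (fun y => by
      obtain ⟨t, -, ⟨x, hx⟩, htG⟩ := hmeet (.inr y)
      exact ⟨x, htG hx⟩)
    (fun s hs => by
      obtain ⟨t, hst, ht, -⟩ := hfin (s.image Prod.swap) (by
        rw [Finset.coe_image]
        exact Set.image_subset_iff.2 hs)
      exact ⟨_, fun p hp => Finset.mem_image.2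
        ⟨p.swap, hst (Finset.mem_image_of_mem _ hp), p.swap_swap⟩, ht.image_swap.isPartialHom⟩)
  have hτρ : ∀ x, τ (ρ x) = x := fun x => (hτ (ρ x, x)).1 ((hρ (x, ρ x)).2 rfl)
  have hρτ : ∀ y, ρ (τ y) = y := fun y => (hρ (τ y, y)).1 ((hτ (y, τ y)).2 rfl)
  refine ⟨{ toFun := ρ, invFun := τ, left_inv := hτρ, right_inv := hρτ,
            map_fun' := ρ.map_fun, map_rel' := fun R x => ⟨fun hx => ?_, ρ.map_rel R x⟩ }, ?_⟩
  · have := τ.map_rel R _ hx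
    change Language.Structure.RelMap R (fun i => τ (ρ (x i))) at this
    simpa only [hτρ] using this
  · exact funext fun i => (hρ (v i, u i)).1
      (ht₀ (hst₀ (Finset.mem_image_of_mem _ (Finset.mem_univ i))))

/-- **Ryll-Nardzewski.** An `ℵ₀`-categorical structure in a countable language is oligomorphic. -/
theorem IsAleph0Categorical.oligomorphic [Countable L.Symbols] (h : IsAleph0Categorical L A) :
    Oligomorphic L A := by
  intro k
  obtain hA | hA := finite_or_infinite A
  · exact ⟨Set.univ, Set.finite_univ, fun v => ⟨v, trivial, .refl L A, rfl⟩⟩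
  obtain hfin | ⟨_, hcat⟩ := h
  · exact (not_finite A).elim
  obtain ⟨F, hF, hcov⟩ := exists_finite_definableLE (α := Fin k) hcat
  refine ⟨F, hF, fun v => ?_⟩
  obtain ⟨u, hu, huv⟩ := hcov v
  exact ⟨u, hu, huv.exists_equiv (isIsolated_of_categorical hcat)⟩

theorem IsAleph0Categorical.countable (h : IsAleph0Categorical L A) : Countable A :=
  h.elim (fun _ => Finite.to_countable) And.left

end RyllNardzewski

end PosExInterp

theorem mainTheorem2 {L : Language} {L' : Language}
    (hLc : Countable L.Symbols) (hLf : PosExInterp.NoFunctionSymbols L)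
    (hLc' : Countable L'.Symbols) (hLf' : PosExInterp.NoFunctionSymbols L')
    (A : Type*) [L.Structure A] [Nonempty A] (B : Type*) [L'.Structure B]
    (hA : PosExInterp.IsAleph0Categorical L A) (hnc : ¬ PosExInterp.Contractible L A) :
    (PosExInterp.PosExInterpretable L A L' B ↔
      ∃ f : (A →[L] A) →* (B →[L'] B), Continuous f ∧
        PosExInterp.CoveredByFinitelyManyOrbits (Set.range f)) ∧
    (PosExInterp.PosExInterpretable L A L' B ↔
      ∃ f : (A →[L] A) →* (B →[L'] B), Continuous f ∧
        PosExInterp.CoveredByFinitelyManyOrbits (f '' PosExInterp.autSet L A)) ∧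
    (∀ f : (A →[L] A) →* (B →[L'] B), Continuous f →
      (PosExInterp.CoveredByFinitelyManyOrbits (Set.range f) ↔
        PosExInterp.CoveredByFinitelyManyOrbits (f '' PosExInterp.autSet L A))) := by
  have hA' : PosExInterp.Oligomorphic L A := hA.oligomorphic
  have : Countable A := hA.countable
  refine ⟨⟨fun h => ?_, fun ⟨f, hf, hB⟩ => hA'.posExInterpretable hnc hf hB⟩,
    ⟨fun h => h.exists_continuous_hom hA', fun ⟨f, hf, hB⟩ => ?_⟩,
    fun f hf => hA'.coveredByFinitelyManyOrbits_iff hf⟩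
  · obtain ⟨f, hf, hB⟩ := h.exists_continuous_hom hA'
    exact ⟨f, hf, (hA'.coveredByFinitelyManyOrbits_iff hf).2 hB⟩
  · exact hA'.posExInterpretable hnc hf ((hA'.coveredByFinitelyManyOrbits_iff hf).2 hB)
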